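/- \textbf{Model.} A network with in-block memory has $K$ nodes $\mathcal K=\{1,\dots,K\}$, a block length $L\ge 1$, finite input alphabets $\mathcal X_{k,i}$ and finite output alphabets $\mathcal Y_{k,i}$ for node $k$ at position $i\in\{1,\dots,L\}$ of a block, a noise variable $Z$ with an arbitrary law on a measurable space, and functions $f_{k,i}$ (measurable in the noise). The network is used $n=mL$ times, $m\ge1$. At position $i$ of block $b$ node $k$ receives $$Y_{k,(b-1)L+i}=f_{k,i}\bigl(X_{\mathcal K,(b-1)L+1},\dots,X_{\mathcal K,(b-1)L+i},Z_b\bigr),$$ where $Z_1,\dots,Z_m$ are independent copies of $Z$. Node $k$ has messages $W_{k1},\dots,W_{kM_k}$; all messages are mutually independent and independent of the noise, and $W_{kj}$ is uniformly distributed on a finite set of $N_{kj}\ge 1$ elements, so that its rate is $R_{kj}=(\log_2 N_{kj})/n$. Node $k$ sends $X_{k,t}=\mathbf a_{k,t}(W_{k1},\dots,W_{kM_k},Y_{k,1},\dots,Y_{k,t-1})$, and from its own messages and $Y_k^n$ it forms estimates of the messages $W_{\ell j}$, $(\ell,j)\in\mathcal D(k)$, where $\mathcal D(k)$ is a given set of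 indices with $\ell\neq k$. The error probability $P_e$ is the probability that at least one of these estimates, at any node, is wrong. The capacity region $\mathcal C$ is the closure of the set of rate tuples $(R_{kj})$ such that for every $\epsilon>0$ there are an $n=mL$, functions $\mathbf a_{k,t}$ and decoders with these rates and $P_e\le\epsilon$. \textbf{One-block quantities.} Let $\mathbf A_k^L=(\mathbf A_{k,1},\dots,\mathbf A_{k,L})$ range over the finite set of one-block code functions of node $k$, $\mathbf a_{k,i}:\mathcal Y_{k,1}\times\dots\times\mathcal Y_{k,i-1}\to\mathcal X_{k,i}$, and let $P(y_{\mathcal K}^L\|x_{\mathcal K}^L)=\Pr[f_{k,i}(x_{\mathcal K,1},\dots,x_{\mathcal K,i},Z)=y_{k,i}\text{ for all }k,i]$. For a probability distribution $P_{\mathbf A_{\mathcal K}^L}$ on tuples of one-block code functions of all nodes (possibly dependent across nodes) let $(\mathbf A_{\mathcal K}^L,X_{\mathcal K}^L,Y_{\mathcal K}^L)$ have the joint law $$P(\mathbf a_{\mathcal K}^L)\Bigl[\prod_{k=1}^K\prod_{i=1}^L 1\{x_{k,i}=\mathbf a_{k,i}(y_{k,1},\dots,y_{k,i-1})\}\Bigr]P(y_{\mathcal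 K}^L\|x_{\mathcal K}^L).$$ For $\mathcal S\subseteq\mathcal K$ let $\mathcal M(\mathcal S)$ be the set of message indices $(k,j)$ with $k\in\mathcal S$ and $(k,j)\in\mathcal D(\ell)$ for some $\ell\in\mathcal S^c$, and let $\mathcal R(P_{\mathbf A_{\mathcal K}^L},\mathcal S)$ be the set of non-negative rate tuples with $$\sum_{(k,j)\in\mathcal M(\mathcal S)}R_{kj}\le \frac1L\, I\bigl(\mathbf A_{\mathcal S}^L;Y_{\mathcal S^c}^L\,\big|\,\mathbf A_{\mathcal S^c}^L\bigr)\quad\text{(in bits)}.$$ \textbf{Theorem.} $$\mathcal C\subseteq\bigcup_{P_{\mathbf A_{\mathcal K}^L}}\ \bigcap_{\mathcal S\subseteq\mathcal K}\mathcal R(P_{\mathbf A_{\mathcal K}^L},\mathcal S).$$ -/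

import Mathlib

open MeasureTheory

noncomputable section

namespace NiBM

/-! ### Finite-alphabet information measures (base 2) -/

section Information

variable {Ω α β γ : Type*} [Fintype Ω] [Fintype α] [Fintype β] [Fintype γ]

open Classical in
/-- The probability that the random variable `U` takes the value `u` under the mass function `p`. -/
def law (p : Ω → ℝ) (U : Ω → α) (u : α) : ℝ :=
  ∑ ω : Ω, if U ω = u then p ω else 0

/-- Shannon entropy `H(U)` in bits (`Real.logb 2 0 = 0` gives the convention `0 log 0 = 0`). -/
def entropy (p : Ω → ℝ) (U : Ω → α) : ℝ :=
  -∑ u : α, law p U u * Real.logb 2 (law p U u)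

/-- Conditional entropy `H(V | W) = H(V, W) - H(W)`. -/
def condEntropy (p : Ω → ℝ) (V : Ω → β) (W : Ω → γ) : ℝ :=
  entropy p (fun ω => (V ω, W ω)) - entropy p W

/-- Conditional mutual information `I(U ; V | W) = H(V | W) - H(V | U, W)`. -/
def condMutualInfo (p : Ω → ℝ) (U : Ω → α) (V : Ω → β) (W : Ω → γ) : ℝ :=
  condEntropy p V W - condEntropy p V (fun ω => (U ω, W ω))

end Information

/-! ### The network -/

/-- A network with `K` nodes and in-block memory of block length `L`. Node `k` has the input
alphabet `X k i` and the output alphabet `Y k i` at position `i` of every block. The noise of one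
block has the law `noise` on `Z`, and node `k` receives `f k i (x restricted to positions ≤ i) z`
at position `i`, where `x` holds the inputs of all nodes in the current block. -/
structure Network (K L : ℕ) (X Y : Fin K → Fin L → Type*) (Z : Type*) [MeasurableSpace Z] where
  noise : Measure Z
  isProbabilityMeasure_noise : IsProbabilityMeasure noise
  f : (k : Fin K) → (i : Fin L) → ((l : Fin K) → (j : Set.Iic i) → X l j) → Z → Y k i
  measurableSet_f : ∀ k i x y, MeasurableSet {z | f k i x z = y}

/-- Time indices for `n = m L` channel uses: the pair `(b, i)` is position `i` of block `b`,
that is, the time `b L + i` (everything counted from `0`). -/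
abbrev Time (m L : ℕ) : Type := Fin m × Fin L

/-- `s` is a strictly earlier time than `t`. -/
def Earlier {m L : ℕ} (s t : Time m L) : Prop :=
  s.1 < t.1 ∨ (s.1 = t.1 ∧ s.2 < t.2)

/-- Indices of messages: `⟨k, j⟩` is message `j` of node `k`, which has `M k` messages. -/
abbrev MsgIdx {K : ℕ} (M : Fin K → ℕ) : Type := (k : Fin K) × Fin (M k)

section Coding

variable {K L : ℕ} {X Y : Fin K → Fin L → Type*} {Z : Type*} [MeasurableSpace Z]
  {M : Fin K → ℕ}

/-- A code with feedback for `m` blocks. Message `p` takes values in `Fin (N p)`, and node `k`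
has to estimate the messages in `D k`. The input of node `k` at time `t` is a function of its own
messages and of its own strictly past outputs; its decisions are a function of its own messages
and all its outputs. -/
structure Code (X Y : Fin K → Fin L → Type*) (D : Fin K → Finset (MsgIdx M)) (m : ℕ)
    (N : MsgIdx M → ℕ) where
  enc : (k : Fin K) → (t : Time m L) → ((j : Fin (M k)) → Fin (N ⟨k, j⟩)) →
    ((s : {s : Time m L // Earlier s t}) → Y k s.1.2) → X k t.2
  dec : (k : Fin K) → ((j : Fin (M k)) → Fin (N ⟨k, j⟩)) → ((t : Time m L) → Y k t.2) →
    (p : {p : MsgIdx M // p ∈ D k}) → Fin (N p.1)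

/-- The outputs of all nodes at time `t`, for the messages `w` and the noise realization `z`
(one noise value per block). -/
def output (net : Network K L X Y Z) {D : Fin K → Finset (MsgIdx M)} {m : ℕ} {N : MsgIdx M → ℕ}
    (c : Code X Y D m N) (w : (p : MsgIdx M) → Fin (N p)) (z : Fin m → Z) (t : Time m L)
    (k : Fin K) : Y k t.2 :=
  net.f k t.2
    (fun l j => c.enc l (t.1, j.1) (fun q => w ⟨l, q⟩) (fun s => output net c w z s.1 l))
    (z t.1)
termination_by (t.1.val, t.2.val)
decreasing_by
  obtain ⟨s, hs⟩ := s
  obtain ⟨j, hj⟩ := j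
  have hj' : j.val ≤ t.2.val := hj
  rcases hs with h | ⟨h, h'⟩
  · exact Prod.Lex.left _ _ h
  · have h1 : s.1.val = t.1.val := congrArg Fin.val h
    have h2 : s.2.val < j.val := h'
    simp only [h1]
    exact Prod.Lex.right _ (lt_of_lt_of_le h2 hj')

/-- The probability that some node decides wrongly on some message it has to estimate. The
messages are independent and uniformly distributed (that is, uniform on the product), and
the block noises are independent with law `net.noise` and independent of the messages. -/
def errorProb (net : Network K L X Y Z) {D : Fin K → Finset (MsgIdx M)} {m : ℕ}
    {N : MsgIdx M → ℕ} (c : Code X Y D m N) : ℝ :=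
  (∑ w : (p : MsgIdx M) → Fin (N p),
      (Measure.pi (fun _ : Fin m => net.noise)).real
        {z | ∃ k : Fin K, ∃ p : {p : MsgIdx M // p ∈ D k},
          c.dec k (fun q => w ⟨k, q⟩) (fun t => output net c w z t k) p ≠ w p.1}) /
    ∏ p : MsgIdx M, (N p : ℝ)

/-- The rate tuple `R` (bits per channel use) is achieved with arbitrarily small error
probability, the network being used `n = m L` times with `m ≥ 1`. -/
def Achievable (net : Network K L X Y Z) (D : Fin K → Finset (MsgIdx M))
    (R : MsgIdx M → ℝ) : Prop :=
  ∀ ε : ℝ, 0 < ε → ∃ m : ℕ, 0 < m ∧ ∃ N : MsgIdx M → ℕ,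
    (∀ p, 0 < N p) ∧ (∀ p, R p = Real.logb 2 (N p) / ((m : ℝ) * (L : ℝ))) ∧
    ∃ c : Code X Y D m N, errorProb net c ≤ ε

/-- The capacity region. -/
def capacityRegion (net : Network K L X Y Z) (D : Fin K → Finset (MsgIdx M)) :
    Set (MsgIdx M → ℝ) :=
  closure {R | Achievable net D R}

end Coding

/-! ### The cut-set region -/

section Cut

variable {K L : ℕ}

/-- Code functions `a_k^L` of node `k` for one block: the input at position `i` as a function of
the outputs of node `k` at the strictly earlier positions of the block. -/
abbrev BlockCode (X Y : Fin K → Fin L → Type*) (k : Fin K) : Type _ :=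
  (i : Fin L) → ((j : Set.Iio i) → Y k j) → X k i

/-- Tuples of one-block code functions of all nodes. -/
abbrev BlockCodes (X Y : Fin K → Fin L → Type*) : Type _ := (k : Fin K) → BlockCode X Y k

/-- One block of letters of all nodes. -/
abbrev Block (X : Fin K → Fin L → Type*) : Type _ := (k : Fin K) → (i : Fin L) → X k i

variable {X Y : Fin K → Fin L → Type*} {Z : Type*} [MeasurableSpace Z] {M : Fin K → ℕ}

/-- The block channel `P(y_K^L ‖ x_K^L)`: the probability that the outputs of one block are `y`
when the inputs are held at `x`. -/
def channel (net : Network K L X Y Z) (x : Block X) (y : Block Y) : ℝ :=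
  net.noise.real {z | ∀ k i, net.f k i (fun l j => x l j) z = y k i}

open Classical in
/-- The deterministic factor `1(x_k^L ‖ a_k^L, 0 y_k^{L-1})`. -/
def inputIndicator {k : Fin K} (a : BlockCode X Y k) (x : (i : Fin L) → X k i)
    (y : (i : Fin L) → Y k i) : ℝ :=
  ∏ i : Fin L, if x i = a i (fun j => y j) then 1 else 0

/-- The joint law of code functions, inputs and outputs of one block when the code functions
have the (arbitrary, possibly dependent) joint law `P`. -/
def jointLaw (net : Network K L X Y Z) (P : BlockCodes X Y → ℝ) :
    BlockCodes X Y × Block X × Block Y → ℝ :=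
  fun ω => P ω.1 * (∏ k : Fin K, inputIndicator (ω.1 k) (ω.2.1 k) (ω.2.2 k)) *
    channel net ω.2.1 ω.2.2

/-- Messages separated from one of their estimates by the cut `(S, Sᶜ)`. -/
def separated (D : Fin K → Finset (MsgIdx M)) (S : Finset (Fin K)) : Finset (MsgIdx M) :=
  {p : MsgIdx M | p.1 ∈ S ∧ ∃ l ∈ Sᶜ, p ∈ D l}

variable [∀ k i, Fintype (X k i)] [∀ k i, Fintype (Y k i)] [∀ k i, DecidableEq (Y k i)]

/-- `I(A_S^L ; Y_{Sᶜ}^L | A_{Sᶜ}^L)` under the joint law `jointLaw net P`. -/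
def cutInfo (net : Network K L X Y Z) (P : BlockCodes X Y → ℝ) (S : Finset (Fin K)) : ℝ :=
  condMutualInfo (jointLaw net P)
    (fun ω (k : {k // k ∈ S}) => ω.1 k.1)
    (fun ω (k : {k // k ∈ Sᶜ}) => ω.2.2 k.1)
    (fun ω (k : {k // k ∈ Sᶜ}) => ω.1 k.1)

/-- The non-negative rate tuples that satisfy the bound for the cut `(S, Sᶜ)`. -/
def cutRegion (net : Network K L X Y Z) (D : Fin K → Finset (MsgIdx M))
    (P : BlockCodes X Y → ℝ) (S : Finset (Fin K)) : Set (MsgIdx M → ℝ) :=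
  {R | (∀ p, 0 ≤ R p) ∧ ∑ p ∈ separated D S, R p ≤ cutInfo net P S / L}

end Cut

end NiBM

end

/-! Within a block, the tuple of code functions of all nodes is the input of a channel that is
memoryless from block to block (`blockChannel`); a code picks this tuple from the messages and the
outputs of earlier blocks. Let P be the law of the tuple averaged over messages and blocks
(`timeAverage`). This one P serves all cuts at once.

Fix a cut S. Compare the true law p of the outputs with a law q under which, in each block, the
outputs outside S are drawn given only the code functions outside S, with the conditional law
induced by P, and the remaining outputs as in the true channel (`cutChannel`). Under q the
receivers' outputs are dominated by a process that does not involve the separated messages, so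
decoding them all succeeds with probability at most the inverse of their number. The expectation
under p of log(p/q) is exactly m times the cut information of P (`sum_timeAverage_mul`): it is a sum
over blocks of one function of the current tuple and output, so neither a chain rule nor concavity
in P is needed. The inequality log x ≤ x - 1 turns the two facts into a Fano-type bound
(`log_mul_success_le`).

For codes of small error this gives every cut constraint up to ε. The slack vanishes because the cut
information is continuous in P and the simplex is compact (`exists_forall_le_cutInfo`). -/

namespace NiBM

/-! ### Causal products -/

section Causal

variable {m : ℕ} {B U : Type*}

/-- The letters of `y` strictly before position `b`. -/
def past (y : Fin m → B) (b : Fin m) : Fin b → B := fun c => y (Fin.castLE b.isLt.le c)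

/-- The product of the kernels `F b`, each applied to the past and to the present letter. -/
def causalProd (F : (b : Fin m) → (Fin b → B) → B → ℝ) (y : Fin m → B) : ℝ :=
  ∏ b, F b (past y b) (y b)

theorem past_snoc_castSucc (y : Fin m → B) (v : B) (b : Fin m) :
    past (Fin.snoc y v : Fin (m + 1) → B) b.castSucc = past y b := by
  funext c
  exact Fin.snoc_castSucc (α := fun _ => B) v y (Fin.castLE b.isLt.le c)

theorem past_snoc_last (y : Fin m → B) (v : B) :
    past (Fin.snoc y v : Fin (m + 1) → B) (Fin.last m) = y := by
  funext c
  exact Fin.snoc_castSucc (α := fun _ => B) v y c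

theorem causalProd_snoc (F : (b : Fin (m + 1)) → (Fin b → B) → B → ℝ) (y : Fin m → B) (v : B) :
    causalProd F (Fin.snoc y v) =
      causalProd (fun b : Fin m => F b.castSucc) y * F (Fin.last m) y v := by
  simp only [causalProd]
  rw [Fin.prod_univ_castSucc]
  simp only [past_snoc_castSucc, past_snoc_last, Fin.snoc_castSucc, Fin.snoc_last]

theorem causalProd_nonneg {F : (b : Fin m) → (Fin b → B) → B → ℝ} (hF : ∀ b h v, 0 ≤ F b h v)
    (y : Fin m → B) : 0 ≤ causalProd F y :=
  Finset.prod_nonneg fun _ _ => hF _ _ _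

theorem sum_snoc [Fintype B] (f : (Fin (m + 1) → B) → ℝ) :
    ∑ y, f y = ∑ y : Fin m → B, ∑ v, f (Fin.snoc y v) := by
  rw [← (Fin.snocEquiv (fun _ : Fin (m + 1) => B)).sum_comp, Fintype.sum_prod_type_right]
  rfl

theorem comp_snoc (π : B → U) (y : Fin m → B) (v : B) :
    π ∘ (Fin.snoc y v : Fin (m + 1) → B) = Fin.snoc (π ∘ y) (π v) :=
  Fin.comp_snoc π y v

/-- Induction on the last letter: its kernel is summed over the fibres of `π` and absorbed into the
test function, which is why `φ` is arbitrary. An inequality suffices, and the kernels used later may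
lose mass through division by zero. -/
theorem sum_causalProd_comp_le [Fintype B] [Fintype U] [DecidableEq U] (π : B → U)
    (F : (b : Fin m) → (Fin b → B) → B → ℝ) (G : (b : Fin m) → (Fin b → U) → U → ℝ)
    (hF : ∀ b h v, 0 ≤ F b h v) (hG : ∀ b h v, 0 ≤ G b h v)
    (hFG : ∀ b h u, ∑ v with π v = u, F b h v ≤ G b (π ∘ h) u)
    (φ : (Fin m → U) → ℝ) (hφ : ∀ u, 0 ≤ φ u) :
    ∑ y, causalProd F y * φ (π ∘ y) ≤ ∑ u, causalProd G u * φ u := by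
  induction m with
  | zero =>
    rw [Fintype.sum_unique, Fintype.sum_unique]
    simp only [causalProd, Finset.univ_eq_empty, Finset.prod_empty, one_mul]
    exact le_of_eq (congrArg φ (Subsingleton.elim _ _))
  | succ m ih =>
    rw [sum_snoc, sum_snoc]
    simp only [causalProd_snoc, comp_snoc, mul_assoc, ← Finset.mul_sum]
    refine le_trans (Finset.sum_le_sum fun y _ => mul_le_mul_of_nonneg_left ?_
      (causalProd_nonneg (fun b h v => hF b.castSucc h v) y)) (ih (fun b => F b.castSucc)
        (fun b => G b.castSucc) (fun b => hF b.castSucc) (fun b => hG b.castSucc)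
        (fun b => hFG b.castSucc)
        (fun u => ∑ w, G (Fin.last m) u w * φ (Fin.snoc u w))
        (fun u => Finset.sum_nonneg fun w _ => mul_nonneg (hG _ _ _) (hφ _)))
    rw [← Finset.sum_fiberwise (s := Finset.univ) (g := π)]
    refine Finset.sum_le_sum fun u _ => ?_
    refine le_trans (le_of_eq ?_) (mul_le_mul_of_nonneg_right (hFG (Fin.last m) y u) (hφ _))
    rw [Finset.sum_mul]
    refine Finset.sum_congr rfl fun v hv => ?_
    rw [(Finset.mem_filter.1 hv).2]

theorem sum_causalProd_le_one [Fintype B] (F : (b : Fin m) → (Fin b → B) → B → ℝ)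
    (hF : ∀ b h v, 0 ≤ F b h v) (hF1 : ∀ b h, ∑ v, F b h v ≤ 1) :
    ∑ y, causalProd F y ≤ 1 := by
  have := sum_causalProd_comp_le (fun _ : B => ()) F (fun _ _ _ => 1) hF
    (fun _ _ _ => zero_le_one) (fun b h u => by simpa using hF1 b h) (fun _ => 1)
    (fun _ => zero_le_one)
  simpa [causalProd] using this

theorem sum_causalProd [Fintype B] (F : (b : Fin m) → (Fin b → B) → B → ℝ)
    (hF1 : ∀ b h, ∑ v, F b h v = 1) : ∑ y, causalProd F y = 1 := by
  induction m with
  | zero => simp [causalProd]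
  | succ m ih =>
    rw [sum_snoc]
    simp only [causalProd_snoc, ← Finset.mul_sum, hF1, mul_one]
    exact ih _ fun b => hF1 b.castSucc

/-- The tower property: letters after `b` sum out to one, and letter `b` has law `F b` given the
past. -/
theorem sum_causalProd_mul [Fintype B] (F : (b : Fin m) → (Fin b → B) → B → ℝ)
    (hF1 : ∀ b h, ∑ v, F b h v = 1) (b : Fin m) (f : (Fin b → B) → B → ℝ) :
    ∑ y, causalProd F y * f (past y b) (y b) =
      ∑ y, causalProd F y * ∑ v, F b (past y b) v * f (past y b) v := by
  induction m with
  | zero => exact b.elim0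
  | succ m ih =>
    rw [sum_snoc, sum_snoc]
    induction b using Fin.lastCases with
    | last =>
      simp only [causalProd_snoc, past_snoc_last, Fin.snoc_last, mul_assoc, ← Finset.mul_sum]
      refine Finset.sum_congr rfl fun y _ => ?_
      rw [← Finset.sum_mul, hF1, one_mul]
    | cast b =>
      simp only [causalProd_snoc, past_snoc_castSucc, Fin.snoc_castSucc]
      have e : ∀ (y : Fin m → B) (t : ℝ), ∑ v, causalProd (fun b : Fin m => F b.castSucc) y *
          F (Fin.last m) y v * t = causalProd (fun b : Fin m => F b.castSucc) y * t := by
        intro y t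
        rw [← Finset.sum_mul, ← Finset.mul_sum, hF1, mul_one]
      simp only [e]
      exact ih (fun b => F b.castSucc) (fun b => hF1 b.castSucc) b f

end Causal

/-! ### The converse for a finite causal system -/

section Channel

variable {A B C U : Type*} [Fintype B] [DecidableEq U]

/-- The marginal channel from `a` to `π` of the output. -/
noncomputable def margChannel (V : A → B → ℝ) (π : B → U) (a : A) (u : U) : ℝ :=
  ∑ v with π v = u, V a v

theorem margChannel_nonneg {V : A → B → ℝ} (hV : ∀ a v, 0 ≤ V a v) (π : B → U) (a : A) (u : U) :
    0 ≤ margChannel V π a u :=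
  Finset.sum_nonneg fun _ _ => hV _ _

theorem le_margChannel {V : A → B → ℝ} (hV : ∀ a v, 0 ≤ V a v) (π : B → U) (a : A) (v : B) :
    V a v ≤ margChannel V π a (π v) :=
  Finset.single_le_sum (f := fun v => V a v) (fun _ _ => hV _ _) (by simp)

theorem sum_margChannel [Fintype U] {V : A → B → ℝ} (hV1 : ∀ a, ∑ v, V a v = 1) (π : B → U) (a : A) :
    ∑ u, margChannel V π a u = 1 := by
  rw [← hV1 a]
  exact Finset.sum_fiberwise _ _ _

variable [Fintype A] [DecidableEq C]

/-- The conditional law of `π` of the output given `κ` of the input. -/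
noncomputable def backChannel (P : A → ℝ) (V : A → B → ℝ) (κ : A → C) (π : B → U) (c : C)
    (u : U) : ℝ :=
  (∑ a with κ a = c, P a * margChannel V π a u) / ∑ a with κ a = c, P a

/-- `I(A ; π(B) | κ(A))` in nats. -/
noncomputable def partialInfo (P : A → ℝ) (V : A → B → ℝ) (κ : A → C) (π : B → U) : ℝ :=
  ∑ a, ∑ v, P a * V a v *
    (Real.log (margChannel V π a (π v)) - Real.log (backChannel P V κ π (κ a) (π v)))

theorem backChannel_nonneg {V : A → B → ℝ} (hV : ∀ a v, 0 ≤ V a v)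
    {P : A → ℝ} (hP : ∀ a, 0 ≤ P a) (κ : A → C) (π : B → U) (c : C)
    (u : U) : 0 ≤ backChannel P V κ π c u :=
  div_nonneg (Finset.sum_nonneg fun _ _ => mul_nonneg (hP _) (margChannel_nonneg hV _ _ _))
    (Finset.sum_nonneg fun _ _ => hP _)

/-- Equality fails when the value `c` has mass zero, where the quotient is 0 / 0 = 0. -/
theorem sum_backChannel_le_one [Fintype U] {V : A → B → ℝ} (hV1 : ∀ a, ∑ v, V a v = 1)
    (P : A → ℝ) (κ : A → C) (π : B → U) (c : C) :
    ∑ u, backChannel P V κ π c u ≤ 1 := by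
  simp only [backChannel, ← Finset.sum_div]
  rw [Finset.sum_comm]
  simp only [← Finset.mul_sum, sum_margChannel hV1, mul_one]
  exact div_self_le_one _

theorem backChannel_pos {V : A → B → ℝ} (hV : ∀ a v, 0 ≤ V a v)
    {P : A → ℝ} (hP : ∀ a, 0 ≤ P a) (κ : A → C) (π : B → U) {a : A} {v : B}
    (ha : 0 < P a) (hv : 0 < V a v) : 0 < backChannel P V κ π (κ a) (π v) := by
  refine div_pos (Finset.sum_pos' (fun _ _ => mul_nonneg (hP _) (margChannel_nonneg hV _ _ _))
    ⟨a, by simp, mul_pos ha (hv.trans_le (le_margChannel hV π a v))⟩)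
    (Finset.sum_pos' (fun _ _ => hP _) ⟨a, by simp, ha⟩)

end Channel

/-! ### Averaging the input law over blocks and messages -/

section TimeAverage

variable {m : ℕ} {A B W : Type*} [Fintype B] [Fintype W] [DecidableEq A]

/-- The law of the input averaged over time. -/
noncomputable def timeAverage (V : A → B → ℝ) (α : W → (b : Fin m) → (Fin b → B) → A) (a : A) : ℝ :=
  (∑ w, ∑ y, ∑ b, causalProd (fun b h v => V (α w b h) v) y *
    if α w b (past y b) = a then 1 else 0) / (m * Fintype.card W)

theorem timeAverage_nonneg {V : A → B → ℝ} (hV : ∀ a v, 0 ≤ V a v)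
    (α : W → (b : Fin m) → (Fin b → B) → A) (a : A) : 0 ≤ timeAverage V α a := by
  refine div_nonneg (Finset.sum_nonneg fun w _ => Finset.sum_nonneg fun y _ =>
    Finset.sum_nonneg fun b _ => mul_nonneg (causalProd_nonneg (fun _ _ _ => hV _ _) _) ?_)
    (by positivity)
  split_ifs <;> norm_num

/-- Given the past, the output follows `V` at the chosen input, so only the averaged input law
matters. Since `f` is arbitrary, it may itself involve `timeAverage`, as the information density
does. -/
theorem sum_timeAverage_mul [Fintype A] {V : A → B → ℝ} (hV1 : ∀ a, ∑ v, V a v = 1)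
    (α : W → (b : Fin m) → (Fin b → B) → A) (hm : 0 < m) [Nonempty W] (f : A → B → ℝ) :
    ∑ w, ∑ y, causalProd (fun b h v => V (α w b h) v) y * ∑ b, f (α w b (past y b)) (y b) =
      m * Fintype.card W * ∑ a, ∑ v, timeAverage V α a * V a v * f a v := by
  have hc : (m * Fintype.card W : ℝ) ≠ 0 := by
    have := Fintype.card_pos (α := W)
    positivity
  have e : ∀ a, m * Fintype.card W * ∑ v, timeAverage V α a * V a v * f a v =
      ∑ w, ∑ y, ∑ b, causalProd (fun b h v => V (α w b h) v) y *
        if α w b (past y b) = a then ∑ v, V a v * f a v else 0 := by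
    intro a
    simp only [mul_assoc]
    rw [← Finset.mul_sum, ← mul_assoc, ← mul_assoc, timeAverage, mul_div_cancel₀ _ hc]
    simp only [Finset.sum_mul, mul_assoc, ite_mul, one_mul, zero_mul]
  rw [Finset.mul_sum (Finset.univ : Finset A), Finset.sum_congr rfl fun a _ => e a,
    Finset.sum_comm (s := (Finset.univ : Finset A))]
  refine Finset.sum_congr rfl fun w _ => ?_
  rw [Finset.sum_comm (s := (Finset.univ : Finset A))]
  have e2 : ∀ y : Fin m → B, (∑ a, ∑ b, causalProd (fun b h v => V (α w b h) v) y *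
        if α w b (past y b) = a then ∑ v, V a v * f a v else 0) =
      ∑ b, causalProd (fun b h v => V (α w b h) v) y *
        ∑ v, V (α w b (past y b)) v * f (α w b (past y b)) v := by
    intro y
    rw [Finset.sum_comm]
    refine Finset.sum_congr rfl fun b _ => ?_
    rw [← Finset.mul_sum]
    simp
  simp only [e2, Finset.mul_sum (Finset.univ : Finset (Fin m))]
  rw [Finset.sum_comm]
  conv_rhs => rw [Finset.sum_comm]
  refine Finset.sum_congr rfl fun b _ => ?_
  exact sum_causalProd_mul (fun b h v => V (α w b h) v) (fun _ _ => hV1 _) b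
    (fun h v => f (α w b h) v)

theorem sum_timeAverage [Fintype A] {V : A → B → ℝ} (hV1 : ∀ a, ∑ v, V a v = 1)
    (α : W → (b : Fin m) → (Fin b → B) → A) (hm : 0 < m) [Nonempty W] :
    ∑ a, timeAverage V α a = 1 := by
  have h := sum_timeAverage_mul hV1 α hm (fun _ _ => (1 : ℝ))
  have hc : (0 : ℝ) < m * Fintype.card W := by
    have := Fintype.card_pos (α := W)
    positivity
  simp only [Finset.sum_const, Finset.card_univ, Fintype.card_fin, nsmul_eq_mul, mul_one,
    ← Finset.mul_sum, hV1, ← Finset.sum_mul] at h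
  have h1 : ∀ w, ∑ y, causalProd (fun b h v => V (α w b h) v) y = 1 := fun w =>
    sum_causalProd _ fun _ _ => hV1 _
  simp only [h1, Finset.sum_const, Finset.card_univ, nsmul_eq_mul, mul_one] at h
  nlinarith

/-- Ensures that the logarithms of the conditional law are taken at positive arguments along every
path of positive probability. -/
theorem timeAverage_pos {V : A → B → ℝ} (hV : ∀ a v, 0 ≤ V a v)
    (α : W → (b : Fin m) → (Fin b → B) → A) {w : W} {y : Fin m → B}
    (hy : 0 < causalProd (fun b h v => V (α w b h) v) y) (b : Fin m) :
    0 < timeAverage V α (α w b (past y b)) := by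
  have hm : 0 < m := b.pos
  have hn : ∀ w y b a, 0 ≤ causalProd (fun b h v => V (α w b h) v) y *
      if α w b (past y b) = a then (1 : ℝ) else 0 := fun w y b a =>
    mul_nonneg (causalProd_nonneg (fun _ _ _ => hV _ _) _) (by split_ifs <;> norm_num)
  have : Nonempty W := ⟨w⟩
  have := Fintype.card_pos (α := W)
  refine div_pos (Finset.sum_pos' (fun w _ => Finset.sum_nonneg fun y _ =>
    Finset.sum_nonneg fun b _ => hn _ _ _ _) ⟨w, Finset.mem_univ _, ?_⟩) (by positivity)
  refine Finset.sum_pos' (fun y _ => Finset.sum_nonneg fun b _ => hn _ _ _ _)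
    ⟨y, Finset.mem_univ _, ?_⟩
  exact Finset.sum_pos' (fun b _ => hn _ _ _ _) ⟨b, Finset.mem_univ _, by simpa using hy⟩

end TimeAverage

/-! ### Change of measure to the channel cut between senders and receivers -/

section Converse

variable {m : ℕ} {A B C U W : Type*} [Fintype A] [Fintype B] [Fintype U] [Fintype W]
  [DecidableEq A] [DecidableEq C] [DecidableEq U]

/-- The channel in which `π` of the output depends on the input through `κ` only, and the rest
of the output is generated as in `V`. -/
noncomputable def cutChannel (P : A → ℝ) (V : A → B → ℝ) (κ : A → C) (π : B → U) (a : A)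
    (v : B) : ℝ :=
  backChannel P V κ π (κ a) (π v) * (V a v / margChannel V π a (π v))

omit [Fintype U] [DecidableEq A] in
theorem cutChannel_nonneg {P : A → ℝ} (hP : ∀ a, 0 ≤ P a) {V : A → B → ℝ}
    (hV : ∀ a v, 0 ≤ V a v) (κ : A → C) (π : B → U) (a : A) (v : B) :
    0 ≤ cutChannel P V κ π a v :=
  mul_nonneg (backChannel_nonneg hV hP _ _ _ _) (div_nonneg (hV _ _) (margChannel_nonneg hV _ _ _))

omit [Fintype U] [DecidableEq A] in
-- Summing over a fibre leaves the factor `margChannel / margChannel`, which is 1, or 0 by the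
-- convention for division by zero.
theorem sum_cutChannel_le {P : A → ℝ} (hP : ∀ a, 0 ≤ P a) {V : A → B → ℝ}
    (hV : ∀ a v, 0 ≤ V a v) (κ : A → C) (π : B → U) (a : A) (u : U) :
    ∑ v with π v = u, cutChannel P V κ π a v ≤ backChannel P V κ π (κ a) u := by
  have : ∑ v with π v = u, cutChannel P V κ π a v =
      backChannel P V κ π (κ a) u * (margChannel V π a u / margChannel V π a u) := by
    conv_rhs => rw [margChannel, Finset.sum_div, Finset.mul_sum]
    refine Finset.sum_congr rfl fun v hv => ?_
    rw [cutChannel, (Finset.mem_filter.1 hv).2]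
    rfl
  rw [this]
  exact mul_le_of_le_one_right (backChannel_nonneg hV hP _ _ _ _) (div_self_le_one _)

omit [Fintype U] in
-- This is p log(g q / p) ≤ g q - p, from log x ≤ x - 1, where p and q are the path probabilities
-- under `V` and `cutChannel`. In q / p all factors cancel except `backChannel / margChannel`.
theorem causalProd_mul_log_le {V : A → B → ℝ} (hV : ∀ a v, 0 ≤ V a v) (κ : A → C) (π : B → U)
    (α : W → (b : Fin m) → (Fin b → B) → A) (w : W) (y : Fin m → B) {g : ℝ} (hg : 0 < g) :
    causalProd (fun b h v => V (α w b h) v) y * (Real.log g - ∑ b,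
      (Real.log (margChannel V π (α w b (past y b)) (π (y b))) -
        Real.log (backChannel (timeAverage V α) V κ π (κ (α w b (past y b))) (π (y b))))) ≤
      g * causalProd (fun b h v => cutChannel (timeAverage V α) V κ π (α w b h) v) y -
        causalProd (fun b h v => V (α w b h) v) y := by
  have hq := causalProd_nonneg (F := fun b h v => cutChannel (timeAverage V α) V κ π (α w b h) v)
    (fun b h v => cutChannel_nonneg (timeAverage_nonneg hV α) hV κ π _ _) y
  rcases (causalProd_nonneg (F := fun b h v => V (α w b h) v) (fun _ _ _ => hV _ _) y).eq_or_lt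
    with h0 | hpos
  · rw [← h0]
    nlinarith [mul_nonneg hg.le hq]
  · have hVp : ∀ b, 0 < V (α w b (past y b)) (y b) := fun b =>
      (hV _ _).lt_of_ne' fun h => hpos.ne' (Finset.prod_eq_zero (Finset.mem_univ b) h)
    have hM : ∀ b, 0 < margChannel V π (α w b (past y b)) (π (y b)) := fun b =>
      (hVp b).trans_le (le_margChannel hV π _ _)
    have hR : ∀ b, 0 < backChannel (timeAverage V α) V κ π (κ (α w b (past y b))) (π (y b)) :=
      fun b => backChannel_pos hV (timeAverage_nonneg hV α) κ π (timeAverage_pos hV α hpos b) (hVp b)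
    have hprod : causalProd (fun b h v => cutChannel (timeAverage V α) V κ π (α w b h) v) y =
        causalProd (fun b h v => V (α w b h) v) y *
          ∏ b, backChannel (timeAverage V α) V κ π (κ (α w b (past y b))) (π (y b)) /
            margChannel V π (α w b (past y b)) (π (y b)) := by
      rw [causalProd, causalProd, ← Finset.prod_mul_distrib]
      refine Finset.prod_congr rfl fun b _ => ?_
      rw [cutChannel]
      ring
    have hpr := Finset.prod_pos (s := (Finset.univ : Finset (Fin m)))
      fun b _ => div_pos (hR b) (hM b)
    have hlog := Real.log_le_sub_one_of_pos (mul_pos hg hpr)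
    rw [Real.log_mul hg.ne' hpr.ne', Real.log_prod fun b _ => (div_pos (hR b) (hM b)).ne'] at hlog
    rw [hprod]
    have e : Real.log g - ∑ b,
      (Real.log (margChannel V π (α w b (past y b)) (π (y b))) -
        Real.log (backChannel (timeAverage V α) V κ π (κ (α w b (past y b))) (π (y b)))) =
        Real.log g + ∑ b, Real.log
          (backChannel (timeAverage V α) V κ π (κ (α w b (past y b))) (π (y b)) /
            margChannel V π (α w b (past y b)) (π (y b))) := by
      rw [sub_eq_add_neg, ← Finset.sum_neg_distrib]
      congr 1
      refine Finset.sum_congr rfl fun b _ => ?_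
      rw [Real.log_div (hR b).ne' (hM b).ne', neg_sub]
    rw [e]
    refine (mul_le_mul_of_nonneg_left hlog hpos.le).trans (le_of_eq ?_)
    ring

open Classical in
/-- A system with messages `w` and causally generated inputs `α` satisfies the cut-set bound
whenever a receiver that sees only `π` of the outputs can, under any channel into `π` with inputs
`γ`, succeed with probability at most `1 / N`. -/
theorem log_mul_success_le {V : A → B → ℝ} (hV : ∀ a v, 0 ≤ V a v) (hV1 : ∀ a, ∑ v, V a v = 1)
    [Nonempty W] (hm : 0 < m) (κ : A → C) (π : B → U)
    (α : W → (b : Fin m) → (Fin b → B) → A) (γ : W → (b : Fin m) → (Fin b → U) → C)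
    (hγ : ∀ w b h, κ (α w b h) = γ w b (π ∘ h))
    (T : W → (Fin m → B) → Prop) (τ : W → (Fin m → U) → Prop)
    (hτ : ∀ w y, T w y → τ w (π ∘ y)) {N δ : ℝ} (hN : 0 < N) (hδ : 0 < δ)
    (h : ∀ r : C → U → ℝ,
      N * ∑ w, ∑ u, causalProd (fun b h v => r (γ w b h) v) u * (if τ w u then 1 else 0) ≤
        ∑ w, ∑ u, causalProd (fun b h v => r (γ w b h) v) u) {s : ℝ}
    (hs : s * Fintype.card W =
      ∑ w, ∑ y, causalProd (fun b h v => V (α w b h) v) y * (if T w y then 1 else 0)) :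
    s * Real.log N + (1 - s) * Real.log δ ≤
      m * partialInfo (timeAverage V α) V κ π + Real.log (1 + δ) := by
  set P := timeAverage V α with hPdef
  have hP : ∀ a, 0 ≤ P a := timeAverage_nonneg hV α
  set p : W → (Fin m → B) → ℝ := fun w y => causalProd (fun b h v => V (α w b h) v) y with hp
  set q : W → (Fin m → B) → ℝ := fun w y =>
    causalProd (fun b h v => cutChannel P V κ π (α w b h) v) y with hq
  have hq0 : ∀ w y, 0 ≤ q w y := fun w y =>
    causalProd_nonneg (fun b h v => cutChannel_nonneg hP hV κ π _ _) y
  have hp1 : ∀ w, ∑ y, p w y = 1 := fun w => sum_causalProd _ fun _ _ => hV1 _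
  have hW : (0 : ℝ) < Fintype.card W := by exact_mod_cast Fintype.card_pos
  -- Under `q` the receivers' outputs are dominated by a process driven by their own inputs `γ`
  -- alone.
  have hqφ : ∀ w (φ : (Fin m → U) → ℝ), (∀ u, 0 ≤ φ u) → ∑ y, q w y * φ (π ∘ y) ≤
      ∑ u, causalProd (fun b h v => backChannel P V κ π (γ w b h) v) u * φ u := by
    intro w φ hφ
    refine sum_causalProd_comp_le π _ _ (fun b h v => cutChannel_nonneg hP hV κ π _ _)
      (fun b h v => backChannel_nonneg hV hP _ _ _ _) (fun b h u => ?_) φ hφ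
    rw [← hγ]
    exact sum_cutChannel_le hP hV κ π _ u
  have hr1 : ∀ w, ∑ u, causalProd (fun b h v => backChannel P V κ π (γ w b h) v) u ≤ 1 :=
    fun w => sum_causalProd_le_one _ (fun b h v => backChannel_nonneg hV hP _ _ _ _)
      (fun b h => sum_backChannel_le_one hV1 P κ π _)
  have hq1 : ∑ w, ∑ y, q w y ≤ Fintype.card W := by
    calc ∑ w, ∑ y, q w y ≤ ∑ _w : W, (1 : ℝ) := Finset.sum_le_sum fun w _ => by
          have := hqφ w (fun _ => 1) fun _ => zero_le_one
          simp only [mul_one] at this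
          exact this.trans (hr1 w)
      _ = Fintype.card W := by simp
  have hqT : N * ∑ w, ∑ y, q w y * (if T w y then 1 else 0) ≤ Fintype.card W := by
    calc N * ∑ w, ∑ y, q w y * (if T w y then 1 else 0)
        ≤ N * ∑ w, ∑ u, causalProd (fun b h v => backChannel P V κ π (γ w b h) v) u *
            (if τ w u then 1 else 0) := by
          refine mul_le_mul_of_nonneg_left (Finset.sum_le_sum fun w _ => ?_) hN.le
          refine le_trans (Finset.sum_le_sum fun y _ => mul_le_mul_of_nonneg_left ?_ (hq0 w y))
            (hqφ w (fun u => if τ w u then 1 else 0) fun u => by split_ifs <;> norm_num)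
          by_cases hT : T w y
          · simp [hT, hτ w y hT]
          · simp only [hT, if_false]
            split_ifs <;> norm_num
      _ ≤ ∑ w, ∑ u, causalProd (fun b h v => backChannel P V κ π (γ w b h) v) u :=
          h (backChannel P V κ π)
      _ ≤ ∑ _w : W, (1 : ℝ) := Finset.sum_le_sum fun w _ => hr1 w
      _ = Fintype.card W := by simp
  have hδ1 : 0 < 1 + δ := by linarith
  -- The weight rewards success by `N` and failure by `δ`; since success has `q`-probability at most
  -- 1 / N, dividing by 1 + δ makes its `q`-mean at most 1. The positive `δ` keeps the logarithm
  -- finite on failure.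
  have hmain : ∑ w, ∑ y, p w y * (Real.log ((if T w y then N else δ) / (1 + δ)) -
      ∑ b, (Real.log (margChannel V π (α w b (past y b)) (π (y b))) -
        Real.log (backChannel P V κ π (κ (α w b (past y b))) (π (y b))))) ≤
      ∑ w, ∑ y, ((if T w y then N else δ) / (1 + δ) * q w y - p w y) :=
    Finset.sum_le_sum fun w _ => Finset.sum_le_sum fun y _ =>
      causalProd_mul_log_le hV κ π α w y (div_pos (by split_ifs <;> assumption) hδ1)
  have hR : ∑ w, ∑ y, ((if T w y then N else δ) / (1 + δ) * q w y - p w y) ≤ 0 := by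
    simp only [Finset.sum_sub_distrib, hp1]
    have e : ∑ w, ∑ y, (if T w y then N else δ) / (1 + δ) * q w y ≤
        (N * ∑ w, ∑ y, q w y * (if T w y then 1 else 0) + δ * ∑ w, ∑ y, q w y) / (1 + δ) := by
      rw [Finset.mul_sum, Finset.mul_sum, ← Finset.sum_add_distrib, Finset.sum_div]
      refine Finset.sum_le_sum fun w _ => ?_
      rw [Finset.mul_sum, Finset.mul_sum, ← Finset.sum_add_distrib, Finset.sum_div]
      refine Finset.sum_le_sum fun y _ => ?_
      rw [div_mul_eq_mul_div]
      refine div_le_div_of_nonneg_right ?_ hδ1.le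
      have := mul_nonneg hδ.le (hq0 w y)
      split_ifs <;> nlinarith
    have e2 : (N * ∑ w, ∑ y, q w y * (if T w y then 1 else 0) + δ * ∑ w, ∑ y, q w y) / (1 + δ) ≤
        Fintype.card W := by
      rw [div_le_iff₀ hδ1]
      nlinarith [mul_le_mul_of_nonneg_left hq1 hδ.le]
    have e3 : ∑ _w : W, (1 : ℝ) = Fintype.card W := by simp
    rw [e3]
    linarith
  have hL : ∑ w, ∑ y, p w y * (Real.log ((if T w y then N else δ) / (1 + δ)) -
      ∑ b, (Real.log (margChannel V π (α w b (past y b)) (π (y b))) -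
        Real.log (backChannel P V κ π (κ (α w b (past y b))) (π (y b))))) =
      Fintype.card W * (s * Real.log N + (1 - s) * Real.log δ - Real.log (1 + δ) -
        m * partialInfo P V κ π) := by
    have hI := sum_timeAverage_mul hV1 α hm fun a v => Real.log (margChannel V π a (π v)) -
      Real.log (backChannel P V κ π (κ a) (π v))
    have hg : ∀ w y, p w y * Real.log ((if T w y then N else δ) / (1 + δ)) =
        p w y * (if T w y then 1 else 0) * (Real.log N - Real.log δ) +
          p w y * (Real.log δ - Real.log (1 + δ)) := by
      intro w y
      split_ifs
      · rw [Real.log_div hN.ne' hδ1.ne']; ring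
      · rw [Real.log_div hδ.ne' hδ1.ne']; ring
    simp only [mul_sub (p _ _) (Real.log (_ / _)), hg, Finset.sum_sub_distrib,
      Finset.sum_add_distrib, ← Finset.sum_mul, hp1]
    simp only [Finset.sum_sub_distrib] at hI
    rw [hI, ← hs]
    simp only [partialInfo, Finset.sum_const, Finset.card_univ, nsmul_eq_mul]
    ring
  rw [hL] at hmain
  have := nonpos_of_mul_nonpos_right (hmain.trans hR) hW
  linarith

end Converse

/-! ### Guessing -/

/-- A guess of the coordinates in `s` that depends on the other coordinates only is correct for
a fraction `1 / ∏ p ∈ s, N p` of all tuples. -/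
theorem prod_mul_sum_guess {ι : Type*} [Fintype ι] [DecidableEq ι] {N : ι → ℕ} (s : Finset ι)
    (H : ((p : ι) → Fin (N p)) → ℝ)
    (d : ((p : ι) → Fin (N p)) → (p : {p // p ∈ s}) → Fin (N p))
    (hH : ∀ w w', (∀ p ∉ s, w p = w' p) → H w = H w')
    (hd : ∀ w w', (∀ p ∉ s, w p = w' p) → d w = d w') :
    (∏ p ∈ s, (N p : ℝ)) * ∑ w, H w * (if ∀ p, d w p = w p then 1 else 0) = ∑ w, H w := by
  let e := (Equiv.piEquivPiSubtypeProd (fun p => p ∈ s) fun p => Fin (N p)).symm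
  have e1 : ∀ x, ∀ p : {p // p ∈ s}, e x p = x.1 p := fun x p => by
    simp [e, Equiv.piEquivPiSubtypeProd]
  have e2 : ∀ a a' c, ∀ p ∉ s, e (a, c) p = e (a', c) p := fun a a' c p hp => by
    simp [e, Equiv.piEquivPiSubtypeProd, hp]
  rw [← e.sum_comp, ← e.sum_comp, Fintype.sum_prod_type_right, Fintype.sum_prod_type_right,
    Finset.mul_sum]
  refine Finset.sum_congr rfl fun c _ => ?_
  rcases isEmpty_or_nonempty ((p : {p // p ∈ s}) → Fin (N p)) with hE | ⟨⟨a0⟩⟩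
  · simp
  have h1 : ∀ a, H (e (a, c)) = H (e (a0, c)) := fun a => hH _ _ (e2 a a0 c)
  -- With the other coordinates fixed the guess is constant, so exactly one choice of the
  -- coordinates in `s` is guessed correctly.
  have h2 : ∀ a, (∀ p, d (e (a, c)) p = e (a, c) p) ↔ a = d (e (a0, c)) := by
    intro a
    rw [hd _ _ (e2 a a0 c)]
    simp only [e1]
    exact ⟨fun h => funext fun p => (h p).symm, fun h p => by rw [h]⟩
  simp only [h1, h2, ← Finset.mul_sum]
  rw [Finset.sum_ite_eq' Finset.univ]
  simp only [Finset.mem_univ, if_true, mul_one, Finset.sum_const, Finset.card_univ,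
    nsmul_eq_mul, Fintype.card_pi, Fintype.card_fin, Nat.cast_prod]
  rw [Finset.prod_coe_sort s (fun p => (N p : ℝ))]

theorem prod_mul_sum_sum_guess {ι T : Type*} [Fintype ι] [DecidableEq ι] [Fintype T] {N : ι → ℕ}
    (s : Finset ι) (H : ((p : ι) → Fin (N p)) → T → ℝ)
    (d : T → ((p : ι) → Fin (N p)) → (p : {p // p ∈ s}) → Fin (N p))
    (hH : ∀ u w w', (∀ p ∉ s, w p = w' p) → H w u = H w' u)
    (hd : ∀ u w w', (∀ p ∉ s, w p = w' p) → d u w = d u w')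
    [∀ w u, Decidable (∀ p, d u w p = w p)] :
    (∏ p ∈ s, (N p : ℝ)) * ∑ w, ∑ u, H w u * (if ∀ p, d u w p = w p then 1 else 0) =
      ∑ w, ∑ u, H w u := by
  rw [Finset.sum_comm, Finset.mul_sum, Finset.sum_comm (s := Finset.univ)]
  refine Finset.sum_congr rfl fun u _ => ?_
  rw [← prod_mul_sum_guess s (fun w => H w u) (d u) (hH u) (hd u)]
  congr 1
  refine Finset.sum_congr rfl fun w _ => ?_
  congr

/-! ### Information measures -/

section Information

variable {Ω α β γ : Type*} [Fintype Ω] [Fintype α] [Fintype β] [Fintype γ]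

theorem entropy_eq_sum (p : Ω → ℝ) (U : Ω → α) :
    entropy p U = -∑ ω, p ω * Real.logb 2 (law p U (U ω)) := by
  classical
  rw [entropy]
  congr 1
  have : ∀ u, law p U u * Real.logb 2 (law p U u) =
      ∑ ω, if U ω = u then p ω * Real.logb 2 (law p U (U ω)) else 0 := by
    intro u
    conv_lhs => rw [law, Finset.sum_mul]
    refine Finset.sum_congr rfl fun ω _ => ?_
    split_ifs with h
    · subst h; rfl
    · simp
  simp only [this]
  rw [Finset.sum_comm]
  simp

theorem continuous_entropy {T : Type*} [TopologicalSpace T] {p : T → Ω → ℝ}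
    (hp : ∀ ω, Continuous fun t => p t ω) (U : Ω → α) : Continuous fun t => entropy (p t) U := by
  refine (continuous_finsetSum _ fun u _ => ?_).neg
  have hl : Continuous fun t => law (p t) U u := by
    refine continuous_finsetSum _ fun ω _ => ?_
    split_ifs
    · exact hp ω
    · exact continuous_const
  have := (Real.continuous_mul_log.comp hl).div_const (Real.log 2)
  simpa only [Real.logb, Function.comp_def, mul_div_assoc] using this

theorem continuous_condMutualInfo {T : Type*} [TopologicalSpace T] {p : T → Ω → ℝ}
    (hp : ∀ ω, Continuous fun t => p t ω) (U : Ω → α) (V : Ω → β) (W : Ω → γ) :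
    Continuous fun t => condMutualInfo (p t) U V W :=
  ((continuous_entropy hp _).sub (continuous_entropy hp _)).sub
    ((continuous_entropy hp _).sub (continuous_entropy hp _))

end Information

/-! ### One block -/

section Block

variable {K L : ℕ} {X Y : Fin K → Fin L → Type*} {Z : Type*} [MeasurableSpace Z]

/-- The inputs that the code functions `a` produce from the outputs `y`. -/
def blockInput (a : BlockCodes X Y) (y : Block Y) : Block X := fun k i => a k i fun j => y k j

/-- The noise values for which the code functions `a` lead to the outputs `y`. -/
def outputEvent (net : Network K L X Y Z) (a : BlockCodes X Y) (y : Block Y) : Set Z :=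
  {z | ∀ k i, net.f k i (fun l j => blockInput a y l j) z = y k i}

/-- The channel from code functions to outputs. -/
def blockChannel (net : Network K L X Y Z) (a : BlockCodes X Y) (y : Block Y) : ℝ :=
  channel net (blockInput a y) y

theorem blockChannel_eq (net : Network K L X Y Z) (a : BlockCodes X Y) (y : Block Y) :
    blockChannel net a y = net.noise.real (outputEvent net a y) := rfl

theorem blockChannel_nonneg (net : Network K L X Y Z) (a : BlockCodes X Y) (y : Block Y) :
    0 ≤ blockChannel net a y := measureReal_nonneg

theorem measurableSet_outputEvent (net : Network K L X Y Z) (a : BlockCodes X Y) (y : Block Y) :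
    MeasurableSet (outputEvent net a y) := by
  simp only [outputEvent, Set.ofPred_forall]
  exact MeasurableSet.iInter fun k => MeasurableSet.iInter fun i => net.measurableSet_f k i _ _

/-- Induction on the position: outputs at `i` depend on the noise and on inputs up to `i`, which use
only outputs strictly before `i`. -/
theorem eq_of_mem_outputEvent {net : Network K L X Y Z} {a : BlockCodes X Y} {y y' : Block Y}
    {z : Z} (h : z ∈ outputEvent net a y) (h' : z ∈ outputEvent net a y') : y = y' := by
  have key : ∀ i k, y k i = y' k i := by
    intro i
    induction i using WellFoundedLT.induction with
    | ind i ih =>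
      intro k
      rw [← h k i, ← h' k i]
      congr 1
      funext l j
      refine congrArg (a l j) (funext fun j' => ih _ ?_ l)
      exact lt_of_lt_of_le (Set.mem_Iio.1 j'.2) (Set.mem_Iic.1 j.2)
  funext k i
  exact key i k

/-- The code for a single block without messages that uses given code functions. -/
def Code.ofBlockCodes (a : BlockCodes X Y) :
    Code (M := fun _ => 0) X Y (fun _ => ∅) 1 (fun _ => 1) where
  enc k t _ h := a k t.2 fun j => h ⟨(t.1, j), Or.inr ⟨rfl, j.2⟩⟩
  dec _ _ _ p := absurd p.2 (Finset.notMem_empty _)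

theorem exists_mem_outputEvent (net : Network K L X Y Z) (a : BlockCodes X Y) (z : Z) :
    ∃ y, z ∈ outputEvent net a y := by
  refine ⟨fun k i => output net (Code.ofBlockCodes a) (fun _ => 0) (fun _ => z) (0, i) k,
    fun k i => ?_⟩
  change _ = output net (Code.ofBlockCodes a) (fun _ => 0) (fun _ => z) (0, i) k
  rw [output]
  rfl

variable [∀ k i, Fintype (Y k i)]

/-- For fixed code functions each noise value leads to exactly one output block, so the events
partition the noise space. -/
theorem sum_blockChannel (net : Network K L X Y Z) (a : BlockCodes X Y) :
    ∑ y, blockChannel net a y = 1 := by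
  have := net.isProbabilityMeasure_noise
  simp only [blockChannel_eq]
  rw [← measureReal_biUnion_finset
    (fun y _ y' _ hyy' => Set.disjoint_left.2 fun z h h' => hyy' (eq_of_mem_outputEvent h h'))
    fun y _ => measurableSet_outputEvent net a y]
  have : (⋃ y ∈ (Finset.univ : Finset (Block Y)), outputEvent net a y) = Set.univ :=
    Set.eq_univ_of_forall fun z => by
      simpa using exists_mem_outputEvent net a z
  rw [this, probReal_univ]

variable [∀ k i, Fintype (X k i)] [∀ k i, DecidableEq (Y k i)]

/-- The indicators leave the single input block `blockInput a y`, which removes the inputs from all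
later computations. -/
theorem sum_jointLaw_mul (net : Network K L X Y Z) (P : BlockCodes X Y → ℝ)
    (f : BlockCodes X Y → Block Y → ℝ) :
    ∑ ω, jointLaw net P ω * f ω.1 ω.2.2 = ∑ a, ∑ y, P a * blockChannel net a y * f a y := by
  classical
  rw [Fintype.sum_prod_type]
  refine Finset.sum_congr rfl fun a _ => ?_
  rw [Fintype.sum_prod_type_right]
  refine Finset.sum_congr rfl fun y _ => ?_
  have h : ∀ x : Block X, ∏ k : Fin K, inputIndicator (a k) (x k) (y k) =
      if x = blockInput a y then 1 else 0 := by
    intro x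
    simp only [inputIndicator, Finset.prod_ite_zero, Finset.prod_const_one, Finset.mem_univ,
      true_imp_iff]
    congr 1
    rw [eq_iff_iff]
    exact ⟨fun h => funext fun k => funext fun i => h k i, fun h k i => by rw [h]; rfl⟩
  simp only [jointLaw, h]
  rw [Finset.sum_eq_single (blockInput a y)]
  · simp [blockChannel]
  · intro x _ hx
    simp [hx]
  · simp

open Classical in
theorem law_jointLaw {β : Type*} (net : Network K L X Y Z) (P : BlockCodes X Y → ℝ)
    (F : BlockCodes X Y → Block Y → β) (u : β) :
    law (jointLaw net P) (fun ω => F ω.1 ω.2.2) u =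
      ∑ a, ∑ y, P a * blockChannel net a y * if F a y = u then 1 else 0 := by
  rw [← sum_jointLaw_mul, law]
  simp

theorem entropy_jointLaw {β : Type*} [Fintype β] (net : Network K L X Y Z)
    (P : BlockCodes X Y → ℝ) (F : BlockCodes X Y → Block Y → β) :
    entropy (jointLaw net P) (fun ω => F ω.1 ω.2.2) = -∑ a, ∑ y, P a * blockChannel net a y *
      Real.logb 2 (law (jointLaw net P) (fun ω => F ω.1 ω.2.2) (F a y)) := by
  rw [entropy_eq_sum, ← sum_jointLaw_mul net P fun a y =>
    Real.logb 2 (law (jointLaw net P) (fun ω => F ω.1 ω.2.2) (F a y))]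

theorem continuous_cutInfo (net : Network K L X Y Z) (S : Finset (Fin K)) :
    Continuous fun P => cutInfo net P S :=
  continuous_condMutualInfo (fun ω => ((continuous_apply ω.1).mul continuous_const).mul
    continuous_const) _ _ _

set_option maxHeartbeats 1000000 in
open Classical in
theorem cutInfo_eq (net : Network K L X Y Z) {P : BlockCodes X Y → ℝ} (hP : ∀ a, 0 ≤ P a)
    (S : Finset (Fin K)) :
    cutInfo net P S = partialInfo P (blockChannel net)
      (fun a (k : {k // k ∈ Sᶜ}) => a k.1) (fun y (k : {k // k ∈ Sᶜ}) => y k.1) / Real.log 2 := by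
  set κ := fun (a : BlockCodes X Y) (k : {k // k ∈ Sᶜ}) => a k.1 with hκ
  set π := fun (y : Block Y) (k : {k // k ∈ Sᶜ}) => y k.1 with hπ
  set κ' := fun (a : BlockCodes X Y) (k : {k // k ∈ S}) => a k.1 with hκ'
  -- The code functions on the two sides of the cut determine the whole tuple, so the last two laws
  -- reduce to single terms and the factor `P a` cancels between them.
  have hinj : ∀ a a', (κ' a', κ a') = (κ' a, κ a) ↔ a' = a := by
    intro a a'
    refine ⟨fun h => funext fun k => ?_, fun h => by rw [h]⟩
    by_cases hk : k ∈ S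
    · exact congrFun (Prod.ext_iff.1 h).1 ⟨k, hk⟩
    · exact congrFun (Prod.ext_iff.1 h).2 ⟨k, Finset.mem_compl.2 hk⟩
  have l1 : ∀ a y, law (jointLaw net P) (fun ω => (π ω.2.2, κ ω.1)) (π y, κ a) =
      ∑ a' with κ a' = κ a, P a' * margChannel (blockChannel net) π a' (π y) := by
    intro a y
    rw [law_jointLaw net P fun a y => (π y, κ a), Finset.sum_filter]
    refine Finset.sum_congr rfl fun a' _ => ?_
    rw [margChannel, Finset.mul_sum, Finset.sum_filter]
    by_cases h : κ a' = κ a <;> simp [h]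
  have l2 : ∀ a, law (jointLaw net P) (fun ω => κ ω.1) (κ a) = ∑ a' with κ a' = κ a, P a' := by
    intro a
    rw [law_jointLaw net P fun a y => κ a, Finset.sum_filter]
    refine Finset.sum_congr rfl fun a' _ => ?_
    rw [← Finset.sum_mul, ← Finset.mul_sum, sum_blockChannel]
    simp
  have l3 : ∀ a y, law (jointLaw net P) (fun ω => (π ω.2.2, (κ' ω.1, κ ω.1)))
      (π y, (κ' a, κ a)) = P a * margChannel (blockChannel net) π a (π y) := by
    intro a y
    rw [law_jointLaw net P fun a y => (π y, (κ' a, κ a))]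
    rw [Finset.sum_eq_single a]
    · rw [margChannel, Finset.mul_sum, Finset.sum_filter]
      simp
    · intro a' _ ha'
      refine Finset.sum_eq_zero fun y' _ => ?_
      rw [if_neg, mul_zero]
      exact fun h => ha' ((hinj a a').1 (Prod.ext_iff.1 h).2)
    · simp
  have l4 : ∀ a, law (jointLaw net P) (fun ω => (κ' ω.1, κ ω.1)) (κ' a, κ a) = P a := by
    intro a
    rw [law_jointLaw net P fun a y => (κ' a, κ a)]
    rw [Finset.sum_eq_single a]
    · simp [← Finset.mul_sum, sum_blockChannel]
    · intro a' _ ha'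
      simp [mt (hinj a a').1 ha']
    · simp
  have hc : cutInfo net P S =
      (entropy (jointLaw net P) (fun ω => (π ω.2.2, κ ω.1)) -
        entropy (jointLaw net P) (fun ω => κ ω.1)) -
      (entropy (jointLaw net P) (fun ω => (π ω.2.2, (κ' ω.1, κ ω.1))) -
        entropy (jointLaw net P) (fun ω => (κ' ω.1, κ ω.1))) := rfl
  rw [hc, entropy_jointLaw net P fun a y => (π y, κ a), entropy_jointLaw net P fun a _ => κ a,
    entropy_jointLaw net P fun a y => (π y, (κ' a, κ a)),
    entropy_jointLaw net P fun a _ => (κ' a, κ a)]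
  simp only [l1, l2, l3, l4]
  simp only [← Finset.sum_neg_distrib, ← Finset.sum_sub_distrib, partialInfo, Finset.sum_div]
  refine Finset.sum_congr rfl fun a _ => Finset.sum_congr rfl fun y _ => ?_
  rcases (hP a).eq_or_lt with h | ha
  · simp only [← h, zero_mul, neg_zero, sub_zero, zero_div]
  rcases (blockChannel_nonneg net a y).eq_or_lt with h | hy
  · simp only [← h, mul_zero, zero_mul, neg_zero, sub_zero, zero_div]
  have hM := hy.trans_le (le_margChannel (blockChannel_nonneg net) π a y)
  have hM' := margChannel_nonneg (blockChannel_nonneg net) π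
  have h1 : 0 < ∑ a' with κ a' = κ a, P a' * margChannel (blockChannel net) π a' (π y) :=
    Finset.sum_pos' (fun _ _ => mul_nonneg (hP _) (hM' _ _)) ⟨a, by simp, mul_pos ha hM⟩
  have h2 : 0 < ∑ a' with κ a' = κ a, P a' := Finset.sum_pos' (fun _ _ => hP _) ⟨a, by simp, ha⟩
  rw [backChannel, Real.log_div h1.ne' h2.ne']
  simp only [Real.logb]
  rw [Real.log_mul ha.ne' hM.ne']
  ring

end Block

/-! ### Codes -/

section Coding

variable {K L : ℕ} {X Y : Fin K → Fin L → Type*} {Z : Type*} [MeasurableSpace Z]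
  {M : Fin K → ℕ} {D : Fin K → Finset (MsgIdx M)} {m : ℕ} {N : MsgIdx M → ℕ}

/-- The code function of node `k` in block `b` for given messages and outputs of the
earlier blocks. -/
def nodeCode (c : Code X Y D m N) (k : Fin K) (b : Fin m)
    (w : (j : Fin (M k)) → Fin (N ⟨k, j⟩)) (h : Fin b → (i : Fin L) → Y k i) : BlockCode X Y k :=
  fun i g => c.enc k (b, i) w fun s =>
    if hs : s.1.1 < b then h ⟨s.1.1, hs⟩ s.1.2
    else g ⟨s.1.2, (s.2.resolve_left hs).2⟩

/-- The code functions of all nodes in block `b`. -/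
def nodeCodes (c : Code X Y D m N) (w : (p : MsgIdx M) → Fin (N p)) (b : Fin m)
    (h : Fin b → Block Y) : BlockCodes X Y :=
  fun k => nodeCode c k b (fun q => w ⟨k, q⟩) fun j => h j k

/-- The code functions of the nodes outside `S` in block `b`, given the outputs of these nodes
in the earlier blocks. -/
def receiverCodes (c : Code X Y D m N) (S : Finset (Fin K)) (w : (p : MsgIdx M) → Fin (N p))
    (b : Fin m) (h : Fin b → (k : {k // k ∈ Sᶜ}) → (i : Fin L) → Y k.1 i)
    (k : {k // k ∈ Sᶜ}) : BlockCode X Y k.1 :=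
  nodeCode c k.1 b (fun q => w ⟨k.1, q⟩) fun j => h j k

/-- All nodes decide correctly. -/
def Correct (c : Code X Y D m N) (w : (p : MsgIdx M) → Fin (N p)) (y : Fin m → Block Y) : Prop :=
  ∀ (k : Fin K) (p : {p : MsgIdx M // p ∈ D k}),
    c.dec k (fun q => w ⟨k, q⟩) (fun t => y t.1 k t.2) p = w p.1

theorem mem_outputEvent_output (net : Network K L X Y Z) (c : Code X Y D m N)
    (w : (p : MsgIdx M) → Fin (N p)) (z : Fin m → Z) (b : Fin m) :
    z b ∈ outputEvent net
      (nodeCodes c w b (past (fun b k i => output net c w z (b, i) k) b))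
      (fun k i => output net c w z (b, i) k) := by
  intro k i
  change _ = output net c w z (b, i) k
  rw [output]
  refine congrArg (fun x => net.f k i x (z b)) (funext fun l => funext fun j => ?_)
  refine congrArg (c.enc l (b, j.1) fun q => w ⟨l, q⟩) (funext fun s => ?_)
  obtain ⟨⟨b', i'⟩, hs⟩ := s
  dsimp only
  split_ifs with h
  · rfl
  · have hb : b' = b := (hs.resolve_left h).1
    subst hb
    rfl

theorem Achievable.nonneg {net : Network K L X Y Z} {R : MsgIdx M → ℝ}
    (hR : Achievable net D R) (p : MsgIdx M) : 0 ≤ R p := by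
  obtain ⟨m, -, N, hN, h, -⟩ := hR 1 one_pos
  rw [h p]
  exact div_nonneg (Real.logb_nonneg one_lt_two (Nat.one_le_cast.2 (hN p))) (by positivity)

theorem nonneg_of_mem_capacityRegion {net : Network K L X Y Z}
    {R : MsgIdx M → ℝ} (hR : R ∈ capacityRegion net D)
    (p : MsgIdx M) : 0 ≤ R p :=
  closure_minimal (t := {R : MsgIdx M → ℝ | 0 ≤ R p}) (fun _ hR' => Achievable.nonneg hR' p)
    (isClosed_le continuous_const (continuous_apply p)) hR

variable [∀ k i, Fintype (Y k i)]

open Classical in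
-- Once the outputs `y` are fixed, so are the code functions of every block, and the noise sequences
-- leading to `y` lie in a box whose measure is a product over blocks. The boxes of correctly
-- decoded `y` cover the complement of the error event; a union bound avoids measurability of that
-- event.
theorem one_sub_le_sum_correct (net : Network K L X Y Z) (c : Code X Y D m N)
    (w : (p : MsgIdx M) → Fin (N p)) :
    1 - (Measure.pi (fun _ : Fin m => net.noise)).real
        {z | ∃ k : Fin K, ∃ p : {p : MsgIdx M // p ∈ D k},
          c.dec k (fun q => w ⟨k, q⟩) (fun t => output net c w z t k) p ≠ w p.1} ≤
      ∑ y, causalProd (fun b h v => blockChannel net (nodeCodes c w b h) v) y *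
        if Correct c w y then 1 else 0 := by
  have := net.isProbabilityMeasure_noise
  set μ := Measure.pi (fun _ : Fin m => net.noise)
  set E := {z : Fin m → Z | ∃ k : Fin K, ∃ p : {p : MsgIdx M // p ∈ D k},
    c.dec k (fun q => w ⟨k, q⟩) (fun t => output net c w z t k) p ≠ w p.1}
  let box : (Fin m → Block Y) → Set (Fin m → Z) := fun y =>
    Set.pi Set.univ fun b => outputEvent net (nodeCodes c w b (past y b)) (y b)
  have hbox : ∀ y, μ.real (box y) =
      causalProd (fun b h v => blockChannel net (nodeCodes c w b h) v) y := by
    intro y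
    rw [measureReal_def, Measure.pi_pi, ENNReal.toReal_prod]
    rfl
  have hcov : (Set.univ : Set (Fin m → Z)) ⊆ E ∪ ⋃ y ∈ Finset.univ.filter (Correct c w), box y := by
    intro z _
    by_cases hz : z ∈ E
    · exact Or.inl hz
    · refine Or.inr (Set.mem_biUnion (x := fun b k i => output net c w z (b, i) k) ?_
        fun b _ => mem_outputEvent_output net c w z b)
      have hz' : ¬ ∃ k : Fin K, ∃ p : {p : MsgIdx M // p ∈ D k},
        c.dec k (fun q => w ⟨k, q⟩) (fun t => output net c w z t k) p ≠ w p.1 := hz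
      push Not at hz'
      simpa [Correct] using hz'
  have h1 := measureReal_mono (μ := μ) hcov
  rw [probReal_univ] at h1
  have h2 := measureReal_union_le (μ := μ) E (⋃ y ∈ Finset.univ.filter (Correct c w), box y)
  have h3 := measureReal_biUnion_finset_le (μ := μ) (Finset.univ.filter (Correct c w)) box
  simp only [hbox] at h3
  simp only [mul_ite, mul_one, mul_zero, ← Finset.sum_filter]
  linarith

variable [∀ k i, Fintype (X k i)] [∀ k i, DecidableEq (Y k i)]

set_option maxHeartbeats 400000 in
open Classical in
-- The input law and the success probability `s` come from the code alone, before any cut is chosen;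
-- this is what puts the union over laws outside the intersection over cuts.
theorem exists_sum_log_le (net : Network K L X Y Z) (hm : 0 < m) (hN : ∀ p, 0 < N p)
    (c : Code X Y D m N) {δ : ℝ} (hδ : 0 < δ) :
    ∃ P ∈ stdSimplex ℝ (BlockCodes X Y), ∃ s : ℝ, 1 - errorProb net c ≤ s ∧ s ≤ 1 ∧
      ∀ S : Finset (Fin K),
        s * ∑ p ∈ separated D S, Real.log (N p) + (1 - s) * Real.log δ ≤
          m * (cutInfo net P S * Real.log 2) + Real.log (1 + δ) := by
  have hne : Nonempty ((p : MsgIdx M) → Fin (N p)) := ⟨fun p => ⟨0, hN p⟩⟩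
  have hV := blockChannel_nonneg net
  have hV1 := sum_blockChannel net
  have hcard : (Fintype.card ((p : MsgIdx M) → Fin (N p)) : ℝ) = ∏ p, (N p : ℝ) := by
    simp [Fintype.card_pi]
  have hcpos : (0 : ℝ) < Fintype.card ((p : MsgIdx M) → Fin (N p)) := by
    exact_mod_cast Fintype.card_pos
  set G : ((p : MsgIdx M) → Fin (N p)) → ℝ := fun w =>
    ∑ y, causalProd (fun b h v => blockChannel net (nodeCodes c w b h) v) y *
      if Correct c w y then 1 else 0 with hG
  refine ⟨timeAverage (blockChannel net) (nodeCodes c),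
    ⟨timeAverage_nonneg hV _, sum_timeAverage hV1 _ hm⟩,
    (∑ w, G w) / Fintype.card ((p : MsgIdx M) → Fin (N p)), ?_, ?_, fun S => ?_⟩
  · rw [errorProb, ← hcard, le_div_iff₀ hcpos, sub_mul, one_mul, div_mul_cancel₀ _ hcpos.ne']
    have := Finset.sum_le_sum fun w (_ : w ∈ Finset.univ) => one_sub_le_sum_correct net c w
    have e : ∑ _w : (p : MsgIdx M) → Fin (N p), (1 : ℝ) =
        Fintype.card ((p : MsgIdx M) → Fin (N p)) := by simp
    rw [Finset.sum_sub_distrib, e] at this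
    exact this
  · rw [div_le_one hcpos]
    calc ∑ w, G w ≤ ∑ _w : (p : MsgIdx M) → Fin (N p), (1 : ℝ) := by
          refine Finset.sum_le_sum fun w _ => ?_
          rw [← sum_causalProd (fun b h v => blockChannel net (nodeCodes c w b h) v)
            fun _ _ => hV1 _]
          refine Finset.sum_le_sum fun y _ => mul_le_of_le_one_right
            (causalProd_nonneg (fun _ _ _ => hV _ _) _) ?_
          split_ifs <;> norm_num
      _ = _ := by simp
  · rw [cutInfo_eq net (timeAverage_nonneg hV _), div_mul_cancel₀ _ (Real.log_pos one_lt_two).ne',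
      ← Real.log_prod fun p _ => (Nat.cast_ne_zero.2 (hN p).ne')]
    have hsep : ∀ p : {p // p ∈ separated D S}, ∃ l, l ∈ Sᶜ ∧ p.1 ∈ D l := fun p =>
      (Finset.mem_filter.1 p.2).2.2
    choose l hlS hlD using hsep
    -- Each separated message is guessed by some node outside `S` that must decode it. That node's
    -- own messages are not separated, so the guess ignores the guessed coordinates.
    let d : (Fin m → (k : {k // k ∈ Sᶜ}) → (i : Fin L) → Y k.1 i) → ((p : MsgIdx M) → Fin (N p)) →
        (p : {p // p ∈ separated D S}) → Fin (N p.1) := fun u w p =>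
      c.dec (l p) (fun q => w ⟨l p, q⟩) (fun t => u t.1 ⟨l p, hlS p⟩ t.2) ⟨p.1, hlD p⟩
    have hout : ∀ w w' : (p : MsgIdx M) → Fin (N p), (∀ p ∉ separated D S, w p = w' p) →
        ∀ k ∈ Sᶜ, (fun q => w ⟨k, q⟩) = fun q => w' ⟨k, q⟩ := by
      intro w w' hw k hk
      refine funext fun q => hw _ fun h => ?_
      exact Finset.mem_compl.1 hk (Finset.mem_filter.1 h).2.1
    refine log_mul_success_le hV hV1 hm (fun a (k : {k // k ∈ Sᶜ}) => a k.1)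
      (fun y (k : {k // k ∈ Sᶜ}) => y k.1) (nodeCodes c)
      (receiverCodes c S) (fun _ _ _ => rfl) (Correct c) (fun w u => ∀ p, d u w p = w p.1)
      (fun w y h p => h (l p) ⟨p.1, hlD p⟩)
      (Finset.prod_pos fun p _ => Nat.cast_pos.2 (hN p)) hδ (fun r => ?_)
      (div_mul_cancel₀ _ hcpos.ne')
    have key : (∏ p ∈ separated D S, (N p : ℝ)) * ∑ w, ∑ u,
        causalProd (fun b h v => r (receiverCodes c S w b h) v) u *
          (if ∀ p, d u w p = w p.1 then 1 else 0) =
        ∑ w, ∑ u, causalProd (fun b h v => r (receiverCodes c S w b h) v) u := by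
      refine prod_mul_sum_sum_guess (separated D S)
        (fun w u => causalProd (fun b h v => r (receiverCodes c S w b h) v) u) d
        (fun u w w' hw => ?_) fun u w w' hw => ?_
      · have e : receiverCodes c S w = receiverCodes c S w' := by
          funext b h k
          exact congrArg (fun x => nodeCode c k.1 b x fun j => h j k) (hout w w' hw k.1 k.2)
        exact congrArg (fun γ => causalProd (fun b h v => r (γ b h) v) u) e
      · funext p
        exact congrArg (fun x => c.dec (l p) x (fun t => u t.1 ⟨l p, hlS p⟩ t.2) ⟨p.1, hlD p⟩)
          (hout w w' hw _ (hlS p))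
    rw [← key]
    refine le_of_eq (congrArg _ (Finset.sum_congr rfl fun w _ =>
      Finset.sum_congr rfl fun u _ => ?_))
    congr

theorem exists_forall_sum_le_add (hL : 0 < L) (net : Network K L X Y Z) {R : MsgIdx M → ℝ}
    (hR : Achievable net D R) {ε : ℝ} (hε : 0 < ε) :
    ∃ P ∈ stdSimplex ℝ (BlockCodes X Y), ∀ S : Finset (Fin K),
      ∑ p ∈ separated D S, R p ≤ cutInfo net P S / L + ε := by
  have hT : 0 ≤ ∑ p, R p := Finset.sum_nonneg fun p _ => hR.nonneg p
  set T := ∑ p, R p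
  -- In the end the slack is δ (4 + T): at most 2δ nats from log (1 + δ) and (1 - s) log δ become at
  -- most 4δ bits per use, as m L log 2 ≥ 1/2, and replacing s r by r costs at most δ T.
  set δ := ε / (4 + T + ε) with hδdef
  have hden : 0 < 4 + T + ε := by positivity
  have hδ : 0 < δ := by positivity
  have hδ1 : δ ≤ 1 := (div_le_one hden).2 (by linarith)
  have hδε : δ * (4 + T) ≤ ε := by
    rw [hδdef, div_mul_eq_mul_div, div_le_iff₀ hden]
    nlinarith
  -- Error δ² beats log δ ≥ -1/δ, so that (1 - s) log δ ≥ -δ.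
  obtain ⟨m, hm, N, hN, hRN, c, hc⟩ := hR (δ ^ 2) (by positivity)
  obtain ⟨P, hP, s, hs, hs1, h⟩ := exists_sum_log_le net hm hN c hδ
  refine ⟨P, hP, fun S => ?_⟩
  have hl : 0 < Real.log 2 := Real.log_pos one_lt_two
  have hl2 : 1 / 2 < Real.log 2 := by linarith [Real.log_two_gt_d9]
  have hm1 : (1 : ℝ) ≤ m := Nat.one_le_cast.2 hm
  have hL1 : (1 : ℝ) ≤ L := Nat.one_le_cast.2 hL
  have hmL : (1 : ℝ) ≤ m * L := one_le_mul_of_one_le_of_one_le hm1 hL1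
  have hlog : ∑ p ∈ separated D S, Real.log (N p) =
      m * L * Real.log 2 * ∑ p ∈ separated D S, R p := by
    rw [Finset.mul_sum]
    refine Finset.sum_congr rfl fun p _ => ?_
    rw [hRN p, Real.logb]
    field_simp
  have hr : ∑ p ∈ separated D S, R p ≤ T :=
    Finset.sum_le_univ_sum_of_nonneg fun p => hR.nonneg p
  have hr0 : 0 ≤ ∑ p ∈ separated D S, R p := Finset.sum_nonneg fun p _ => hR.nonneg p
  have hS := h S
  rw [hlog] at hS
  generalize ∑ p ∈ separated D S, R p = r at *
  generalize cutInfo net P S = I at *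
  have hsδ : 1 - s ≤ δ ^ 2 := by linarith
  have h1 : Real.log (1 + δ) ≤ δ := by
    linarith [Real.log_le_sub_one_of_pos (show 0 < 1 + δ by linarith)]
  have h2 : -δ ≤ (1 - s) * Real.log δ := by
    have h3 : -(1 / δ) ≤ Real.log δ := by
      have := Real.one_sub_inv_le_log_of_pos hδ
      rw [one_div]
      linarith
    have h4 : δ ^ 2 * (1 / δ) = δ := by field_simp
    have h5 : (1 - s) * (1 / δ) ≤ δ ^ 2 * (1 / δ) :=
      mul_le_mul_of_nonneg_right hsδ (by positivity)
    have h6 := mul_le_mul_of_nonneg_left h3 (sub_nonneg.2 hs1)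
    linarith
  have hc0 : 0 < m * L * Real.log 2 := by positivity
  have h7 : m * L * Real.log 2 * (s * r - I / L) ≤ m * L * Real.log 2 * (4 * δ) := by
    have e : m * L * Real.log 2 * (I / L) = m * (I * Real.log 2) := by field_simp
    have h8 : 1 / 2 ≤ m * L * Real.log 2 := by nlinarith
    nlinarith
  have h9 := le_of_mul_le_mul_left h7 hc0
  have h10 : (1 - s) * r ≤ δ * T := by
    calc (1 - s) * r ≤ δ ^ 2 * T := mul_le_mul hsδ hr hr0 (by positivity)
      _ ≤ δ * T := mul_le_mul_of_nonneg_right (by nlinarith) hT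
  nlinarith

end Coding

/-! ### The cut-set bound -/

section Cut

variable {K L : ℕ} {X Y : Fin K → Fin L → Type*} [∀ k i, Fintype (X k i)]
  [∀ k i, Fintype (Y k i)] [∀ k i, DecidableEq (Y k i)] {Z : Type*} [MeasurableSpace Z]

/-- By compactness of the simplex, bounds that hold up to an arbitrary slack for some input law
hold exactly for some input law. -/
theorem exists_forall_le_cutInfo (net : Network K L X Y Z) (ρ : Finset (Fin K) → ℝ)
    (h : ∀ ε : ℝ, 0 < ε → ∃ P ∈ stdSimplex ℝ (BlockCodes X Y), ∀ S : Finset (Fin K),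
      ρ S ≤ cutInfo net P S / L + ε) :
    ∃ P ∈ stdSimplex ℝ (BlockCodes X Y), ∀ S : Finset (Fin K), ρ S ≤ cutInfo net P S / L := by
  -- The least margin over the finitely many cuts. Its maximum over the simplex is at least -ε for
  -- every ε > 0, so a maximizer meets all the constraints.
  let φ : (BlockCodes X Y → ℝ) → ℝ := fun P =>
    (Finset.univ : Finset (Finset (Fin K))).inf' Finset.univ_nonempty fun S =>
      cutInfo net P S / L - ρ S
  have hφ : Continuous φ := Continuous.finset_inf'_apply Finset.univ_nonempty fun S _ =>
    ((continuous_cutInfo net S).div_const _).sub continuous_const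
  obtain ⟨P₁, hP₁, -⟩ := h 1 one_pos
  obtain ⟨P, hP, hmax⟩ := (isCompact_stdSimplex ℝ (BlockCodes X Y)).exists_isMaxOn ⟨P₁, hP₁⟩
    hφ.continuousOn
  refine ⟨P, hP, fun S => le_of_forall_pos_le_add fun ε hε => ?_⟩
  obtain ⟨Q, hQ, hQε⟩ := h ε hε
  have h1 : -ε ≤ φ Q := (Finset.le_inf'_iff _ _).2 fun S _ => by linarith [hQε S]
  have h2 : φ P ≤ cutInfo net P S / L - ρ S := Finset.inf'_le _ (Finset.mem_univ S)
  have h3 : φ Q ≤ φ P := hmax hQ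
  linarith

/-- There are finitely many cuts, so an achievable tuple can be found whose sums fall short of those
of `R` by less than ε / 2 for all of them; its code supplies the law. -/
theorem exists_forall_sum_le_add_of_mem_capacityRegion (hL : 0 < L) {M : Fin K → ℕ}
    {net : Network K L X Y Z} {D : Fin K → Finset (MsgIdx M)} {R : MsgIdx M → ℝ}
    (hR : R ∈ capacityRegion net D) {ε : ℝ} (hε : 0 < ε) :
    ∃ P ∈ stdSimplex ℝ (BlockCodes X Y), ∀ S : Finset (Fin K),
      ∑ p ∈ separated D S, R p ≤ cutInfo net P S / L + ε := by
  have hopen : IsOpen {R' : MsgIdx M → ℝ | ∀ S : Finset (Fin K),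
      ∑ p ∈ separated D S, R p < ∑ p ∈ separated D S, R' p + ε / 2} := by
    simp only [Set.ofPred_forall]
    exact isOpen_iInter_of_finite fun S => isOpen_lt continuous_const
      ((continuous_finsetSum _ fun p _ => continuous_apply p).add continuous_const)
  obtain ⟨R', hR', hA⟩ := mem_closure_iff.1 hR _ hopen fun S => by linarith
  obtain ⟨P, hP, h⟩ := exists_forall_sum_le_add hL net hA (half_pos hε)
  exact ⟨P, hP, fun S => by linarith [h S, hR' S]⟩

end Cut

end NiBM

theorem theorem1 {K L : ℕ} (hL : 0 < L) {X Y : Fin K → Fin L → Type*}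
    [∀ k i, Fintype (X k i)] [∀ k i, Fintype (Y k i)] [∀ k i, DecidableEq (Y k i)]
    {Z : Type*} [MeasurableSpace Z] (net : NiBM.Network K L X Y Z)
    {M : Fin K → ℕ} (D : Fin K → Finset (NiBM.MsgIdx M))
    (hD : ∀ k, ∀ p ∈ D k, p.1 ≠ k) :
    NiBM.capacityRegion net D ⊆
      ⋃ P ∈ stdSimplex ℝ (NiBM.BlockCodes X Y), ⋂ S : Finset (Fin K),
        NiBM.cutRegion net D P S := by
  intro R hR
  obtain ⟨P, hP, h⟩ := NiBM.exists_forall_le_cutInfo net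
    (fun S => ∑ p ∈ NiBM.separated D S, R p) fun ε hε =>
      NiBM.exists_forall_sum_le_add_of_mem_capacityRegion hL hR hε
  exact Set.mem_biUnion hP (Set.mem_iInter.2 fun S =>
    ⟨NiBM.nonneg_of_mem_capacityRegion hR, h S⟩)
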